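/- **Theorem 3.1.** Let $E$ be a uniformly convex and uniformly smooth real Banach space with normalized duality mapping $J:E\to E^*$ (so $\langle x,Jx\rangle=\|x\|^2=\|Jx\|^2$; $J$ is a bijection), and put $\phi(x,y)=\|x\|^2-2\langle x,Jy\rangle+\|y\|^2$. Let $C\subseteq E$ be nonempty, closed and convex, and let $f:C\times C\to\mathbb R$ satisfy - (A1) $f(x,x)=0$ for all $x\in C$; - (A2) $f(x,y)\ge 0\Rightarrow f(y,x)\le 0$ for all $x,y\in C$; - (A3) if $u_k,v_k\in C$ converge weakly to $x,y\in C$, then $f(u_k,v_k)\to f(x,y)$; - (A4) for every $x\in C$, $f(x,\cdot)$ is convex, lower semicontinuous and subdifferentiable on $C$; - (A5) there are $c_1,c_2>0$ with $f(x,y)+f(y,z)\ge f(x,z)-c_1\phi(y,x)-c_2\phi(z,y)$ for all $x,y,z\in C$. Let $E(f)=\{x\in C: f(x,y)\ge 0\ \forall y\in C\}$. Let $S:C\to C$ be relatively nonexpansive, i.e. $\phi(p,Sx)\le\phi(p,x)$ for all $x\in C$, $p\in F(S)$, and the fixed point set $F(S)$ equals the set of all $p\in C$ that are weak limits of sequences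 $u_k\in C$ with $Su_k-u_k\to0$. Assume $\Omega=E(f)\cap F(S)\ne\emptyset$. For nonempty $D\subseteq E$, a *sunny generalized nonexpansive retraction* of $E$ onto $D$ is a map $R:E\to D$ with $Rx=x$ for $x\in D$, $R(Rx+s(x-Rx))=Rx$ for all $x\in E$, $s\ge 0$, and $\phi(Rx,p)\le\phi(x,p)$ for all $x\in E$, $p\in D$; it is unique if it exists, and is then denoted $R_D$. Let $0<a<e<1$, $0<d<b<1$, $0<\lambda_{\min}\le\lambda_{\max}<\min\{\frac1{2c_1},\frac1{2c_2}\}$ and, for all $n\ge0$, $\alpha_n\in[a,e]$, $\beta_n\in[d,b]$, $\lambda_n\in(0,1]\cap[\lambda_{\min},\lambda_{\max}]$. Let $x_0\in C$ and let $(x_n),(y_n),(z_n),(t_n)$ be generated by $$y_n=\operatorname*{arg\,min}_{y\in C}\{\lambda_nf(x_n,y)+\tfrac12\phi(y,x_n)\},\qquad z_n=\operatorname*{arg\,min}_{y\in C}\{\lambda_nf(y_n,y)+\tfrac12\phi(y,x_n)\},$$ $$t_n=J^{-1}\big(\alpha_nJx_n+(1-\alpha_n)(\beta_nJz_n+(1-\beta_n)JSz_n)\big),\qquad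 x_{n+1}=R_{C_n\cap D_n}x_0,$$ $$C_n=\{z\in C:\phi(z,t_n)\le\phi(z,x_n)\},\qquad D_n=\{z\in C:\langle x_0-x_n,Jx_n-Jz\rangle\ge0\},$$ where the retractions $R_{C_n\cap D_n}$ are supposed to exist for all $n\ge0$. Then $(x_n),(y_n),(z_n),(t_n)$ all converge strongly to one and the same point $u^*\in\Omega$, and $u^*=R_\Omega x_0$ whenever a sunny generalized nonexpansive retraction $R_\Omega$ of $E$ onto $\Omega$ exists. -/

import Mathlib

open Filter Topology

namespace EquilibriumExtragradient

/-- `E` is uniformly smooth: the limit of `(‖x + s y‖ - ‖x‖) / s` as `s → 0` exists and is attained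
uniformly for `x, y` in the unit sphere (the limit is called `L x y`). -/
def UniformlySmooth (E : Type*) [NormedAddCommGroup E] [NormedSpace ℝ E] : Prop :=
  ∃ L : E → E → ℝ, ∀ ε : ℝ, 0 < ε → ∃ δ : ℝ, 0 < δ ∧
    ∀ x y : E, ‖x‖ = 1 → ‖y‖ = 1 → ∀ s : ℝ, s ≠ 0 → |s| < δ →
      |(‖x + s • y‖ - ‖x‖) / s - L x y| < ε

/-- The (set-valued) normalized duality mapping `E → 2^{E*}`. -/
def dualitySet {E : Type*} [NormedAddCommGroup E] [NormedSpace ℝ E] (x : E) :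
    Set (StrongDual ℝ E) :=
  {ξ | ξ x = ‖x‖ ^ 2 ∧ ‖ξ‖ ^ 2 = ‖x‖ ^ 2}

theorem dualitySet_nonempty {E : Type*} [NormedAddCommGroup E] [NormedSpace ℝ E] (x : E) :
    (dualitySet x).Nonempty := by
  by_cases hx : x = 0
  · exact ⟨0, by simp [dualitySet, hx]⟩
  · obtain ⟨g, hg, hgx⟩ := exists_dual_vector ℝ x (norm_ne_zero_iff.mpr hx)
    refine ⟨‖x‖ • g, ?_, ?_⟩
    · have hgx' : g x = ‖x‖ := by simpa using hgx
      simp [hgx', sq]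
    · simp [norm_smul, hg]

/-- The normalized duality mapping as a map `J : E → E*`. In a smooth space `dualitySet x` has
exactly one element, and `J x` is that element. -/
noncomputable def J {E : Type*} [NormedAddCommGroup E] [NormedSpace ℝ E] (x : E) :
    StrongDual ℝ E :=
  (dualitySet_nonempty x).some

/-- `φ(x, y) = ‖x‖² - 2⟨x, J y⟩ + ‖y‖²`. -/
noncomputable def phi {E : Type*} [NormedAddCommGroup E] [NormedSpace ℝ E] (x y : E) : ℝ :=
  ‖x‖ ^ 2 - 2 * J y x + ‖y‖ ^ 2

/-- Weak convergence of a sequence. -/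
def WeaklyConverges {E : Type*} [NormedAddCommGroup E] [NormedSpace ℝ E]
    (u : ℕ → E) (p : E) : Prop :=
  ∀ ξ : StrongDual ℝ E, Tendsto (fun k => ξ (u k)) atTop (𝓝 (ξ p))

/-- The fixed points in `C` of a self-map of `C`. -/
def fixedPoints {E : Type*} (C : Set E) (T : E → E) : Set E :=
  {p | p ∈ C ∧ T p = p}

/-- The asymptotic fixed points of a self-map of `C`. -/
def asymptoticFixedPoints {E : Type*} [NormedAddCommGroup E] [NormedSpace ℝ E]
    (C : Set E) (T : E → E) : Set E :=
  {p | p ∈ C ∧ ∃ u : ℕ → E, (∀ k, u k ∈ C) ∧ WeaklyConverges u p ∧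
    Tendsto (fun k => T (u k) - u k) atTop (𝓝 0)}

/-- `T` (used only on `C`) is a relatively nonexpansive self-map of `C`. -/
structure RelativelyNonexpansive {E : Type*} [NormedAddCommGroup E] [NormedSpace ℝ E]
    (C : Set E) (T : E → E) : Prop where
  mapsTo : Set.MapsTo T C C
  asymptotic_eq : asymptoticFixedPoints C T = fixedPoints C T
  phi_le : ∀ x ∈ C, ∀ p ∈ fixedPoints C T, phi p (T x) ≤ phi p x

/-- The solution set of the equilibrium problem for `f` on `C`. -/
def equilibriumSet {E : Type*} (C : Set E) (f : E → E → ℝ) : Set E :=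
  {p | p ∈ C ∧ ∀ y ∈ C, 0 ≤ f p y}

/-- `f` vanishes on the diagonal of `C`. -/
def CondA1 {E : Type*} (C : Set E) (f : E → E → ℝ) : Prop :=
  ∀ x ∈ C, f x x = 0

/-- `f` is pseudomonotone on `C`. -/
def CondA2 {E : Type*} (C : Set E) (f : E → E → ℝ) : Prop :=
  ∀ x ∈ C, ∀ y ∈ C, 0 ≤ f x y → f y x ≤ 0

/-- `f` is jointly weakly (sequentially) continuous on `C × C`. -/
def CondA3 {E : Type*} [NormedAddCommGroup E] [NormedSpace ℝ E]
    (C : Set E) (f : E → E → ℝ) : Prop :=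
  ∀ x ∈ C, ∀ y ∈ C, ∀ u v : ℕ → E, (∀ k, u k ∈ C) → (∀ k, v k ∈ C) →
    WeaklyConverges u x → WeaklyConverges v y →
    Tendsto (fun k => f (u k) (v k)) atTop (𝓝 (f x y))

/-- `f(x, ·)` is convex, lower semicontinuous and subdifferentiable on `C` for every `x ∈ C`.
The subgradients are those of `f(x, ·)` extended by `+∞` outside `C`. -/
def CondA4 {E : Type*} [NormedAddCommGroup E] [NormedSpace ℝ E]
    (C : Set E) (f : E → E → ℝ) : Prop :=
  ∀ x ∈ C, ConvexOn ℝ C (f x) ∧ LowerSemicontinuousOn (f x) C ∧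
    ∀ y ∈ C, ∃ ξ : StrongDual ℝ E, ∀ v ∈ C, f x y + ξ (v - y) ≤ f x v

/-- The `φ`-Lipschitz-type condition with constants `c₁`, `c₂`. -/
def CondA5 {E : Type*} [NormedAddCommGroup E] [NormedSpace ℝ E]
    (C : Set E) (f : E → E → ℝ) (c₁ c₂ : ℝ) : Prop :=
  ∀ x ∈ C, ∀ y ∈ C, ∀ z ∈ C, f x z - c₁ * phi y x - c₂ * phi z y ≤ f x y + f y z

/-- `R` is a sunny generalized nonexpansive retraction from `E` onto `D`: a retraction onto `D`
(so that its fixed points are the points of `D`), sunny, and with `F(R) ≠ ∅` and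
`φ(R x, p) ≤ φ(x, p)` for all `x ∈ E` and `p ∈ F(R)`. -/
structure SunnyGeneralizedNonexpansiveRetraction {E : Type*} [NormedAddCommGroup E]
    [NormedSpace ℝ E] (R : E → E) (D : Set E) : Prop where
  mem : ∀ x, R x ∈ D
  retract : ∀ x ∈ D, R x = x
  sunny : ∀ x, ∀ s : ℝ, 0 ≤ s → R (R x + s • (x - R x)) = R x
  nonempty : D.Nonempty
  phi_le : ∀ x, ∀ p ∈ D, phi (R x) p ≤ phi x p

/-- `p` minimizes `g` over `C`. -/
def IsArgminOn {E : Type*} (g : E → ℝ) (C : Set E) (p : E) : Prop :=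
  p ∈ C ∧ ∀ v ∈ C, g p ≤ g v

/-- `{v ∈ C : φ(v, t) ≤ φ(v, x)}`. -/
def cutC {E : Type*} [NormedAddCommGroup E] [NormedSpace ℝ E] (C : Set E) (t x : E) : Set E :=
  {v | v ∈ C ∧ phi v t ≤ phi v x}

/-- `{v ∈ C : ⟨J x - J v, x₀ - x⟩ ≥ 0}`. -/
def cutD {E : Type*} [NormedAddCommGroup E] [NormedSpace ℝ E] (C : Set E) (x₀ x : E) : Set E :=
  {v | v ∈ C ∧ 0 ≤ (J x - J v) (x₀ - x)}

/-- `x, y, z, t` are sequences generated by the extragradient algorithm from `x 0 ∈ C` with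
parameters `α, β, lam`. Since `J` is a bijection of `E` onto `E*` in the spaces considered,
`t = J⁻¹ ξ` is written `J t = ξ`. -/
structure ExtragradientSequences {E : Type*} [NormedAddCommGroup E] [NormedSpace ℝ E]
    (C : Set E) (f : E → E → ℝ) (S : E → E) (α β lam : ℕ → ℝ) (x y z t : ℕ → E) : Prop where
  start : x 0 ∈ C
  y_step : ∀ n, IsArgminOn (fun v => lam n * f (x n) v + (1 / 2) * phi v (x n)) C (y n)
  z_step : ∀ n, IsArgminOn (fun v => lam n * f (y n) v + (1 / 2) * phi v (x n)) C (z n)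
  t_step : ∀ n, J (t n) =
    α n • J (x n) + (1 - α n) • (β n • J (z n) + (1 - β n) • J (S (z n)))
  x_step : ∀ n, ∃ R : E → E,
    SunnyGeneralizedNonexpansiveRetraction R (cutC C (t n) (x n) ∩ cutD C (x 0) (x n)) ∧
      x (n + 1) = R (x 0)

end EquilibriumExtragradient

open EquilibriumExtragradient

namespace EquilibriumExtragradient

/-! ### Uniform smoothness: continuity of the duality map and derivatives of the squared norm. -/

section DualityMap

variable {E : Type*} [NormedAddCommGroup E] [NormedSpace ℝ E]

/-! The iterates have a weak cluster point `p` in Ω. The obstacle is strong convergence: the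
inequality defining `cutD` involves `J v`, so it need not survive weak limits in `v`. Two facts get
around this. The variational inequality of a sunny retraction puts `cutC ∩ cutD` at stage `n` inside
the next `cutD`, so a point lying in every `cutC` lies in every `cutD`. And `φ(v, t) - φ(v, x)` is
affine in `v`, hence weakly continuous (`phi_sub_phi`). The term `α φ(t, x)` kept in `phi_step_le`
makes the inequality of `cutC` strict at points of Ω unless `t n = x n`. So each `cutC`, and
inductively each `cutD`, contains a tail of the weakly convergent subsequence. On `cutD` one has
`φ(x 0, x n) + φ(x n, v) ≤ φ(x 0, v)`. Since `φ(x 0, x n)` increases to a limit, `x n` is close to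
that tail for large `n`, and weak lower semicontinuity of the norm gives closeness to `p`.

To see that `p` lies in Ω: solutions are never cut off, so `φ(x 0, x n)` is bounded and `x n - t n →
0`. The slack in `extragradient_phi_le` then makes `y n` and `z n` merge with `x n`, and the formula
for `J (t n)` yields `S (z n) - z n → 0`. Throughout, uniform convexity turns small `φ` into small
distance, and uniform smoothness makes `J` uniformly continuous on bounded sets. -/

theorem J_apply_self (x : E) : J x x = ‖x‖ ^ 2 :=
  (dualitySet_nonempty x).some_mem.1

theorem norm_J (x : E) : ‖J x‖ = ‖x‖ := by
  have h : ‖J x‖ ^ 2 = ‖x‖ ^ 2 := (dualitySet_nonempty x).some_mem.2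
  exact (sq_eq_sq₀ (norm_nonneg _) (norm_nonneg _)).1 h

theorem J_apply_le (x y : E) : J x y ≤ ‖x‖ * ‖y‖ := by
  have := (J x).le_opNorm y
  rw [norm_J] at this
  exact (le_abs_self _).trans this

/-- `2 J x` is a subgradient of the squared norm at `x`. -/
theorem two_mul_J_sub_le (x y : E) : 2 * J x (y - x) ≤ ‖y‖ ^ 2 - ‖x‖ ^ 2 := by
  have h := J_apply_le x y
  rw [map_sub, J_apply_self]
  nlinarith [sq_nonneg (‖x‖ - ‖y‖)]

theorem apply_le_of_mem_dualitySet {x : E} {ξ : StrongDual ℝ E} (hx : ‖x‖ = 1)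
    (hξ : ξ ∈ dualitySet x) (y : E) (s : ℝ) : s * ξ y ≤ ‖x + s • y‖ - ‖x‖ := by
  have h1 : ‖ξ‖ = 1 := by
    have h := hξ.2
    rw [hx] at h
    exact (sq_eq_sq₀ (norm_nonneg _) zero_le_one).1 h
  have h2 : ξ x = 1 := by rw [hξ.1, hx, one_pow]
  have h3 := (le_abs_self _).trans (ξ.le_opNorm (x + s • y))
  rw [h1, map_add, map_smul, h2, smul_eq_mul, one_mul] at h3
  rw [hx]; linarith

/-- Difference quotients with positive step dominate `ξ y` and those with negative step lie below
it, so their common limit `L x y` is `ξ y`. Arbitrary `ξ ∈ dualitySet x` are allowed because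
rescaled values of `J` are used later. -/
theorem abs_quotient_sub_J_le (hE : UniformlySmooth E) {ε : ℝ} (hε : 0 < ε) :
    ∃ δ : ℝ, 0 < δ ∧ ∀ x y : E, ∀ ξ ∈ dualitySet x, ‖x‖ = 1 → ‖y‖ = 1 → ∀ s : ℝ, s ≠ 0 → |s| < δ →
      |(‖x + s • y‖ - ‖x‖) / s - ξ y| ≤ ε := by
  obtain ⟨L, hL⟩ := hE
  obtain ⟨δ, hδ, h⟩ := hL ε hε
  refine ⟨δ, hδ, fun x y ξ hξ hx hy s hs hsδ => ?_⟩
  suffices hLξ : L x y = ξ y by rw [← hLξ]; exact (h x y hx hy s hs hsδ).le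
  refine eq_of_forall_dist_le fun η hη => ?_
  obtain ⟨δ', hδ', h'⟩ := hL η hη
  have hpos : 0 < δ' / 2 := by positivity
  have habs : |δ' / 2| < δ' := by rw [abs_of_pos hpos]; linarith
  have h1 := abs_lt.1 (h' x y hx hy (δ' / 2) hpos.ne' habs)
  have h2 := abs_lt.1 (h' x y hx hy (-(δ' / 2)) (neg_ne_zero.2 hpos.ne') (by rwa [abs_neg]))
  have h3 := apply_le_of_mem_dualitySet hx hξ y (δ' / 2)
  have h4 := apply_le_of_mem_dualitySet hx hξ y (-(δ' / 2))
  have h5 : ξ y ≤ (‖x + (δ' / 2) • y‖ - ‖x‖) / (δ' / 2) := by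
    rw [le_div_iff₀ hpos]; linarith
  have h6 : (‖x + (-(δ' / 2)) • y‖ - ‖x‖) / (-(δ' / 2)) ≤ ξ y := by
    rw [div_neg, neg_le, le_div_iff₀ hpos]; linarith
  rw [Real.dist_eq, abs_le]
  constructor <;> linarith

theorem smul_J_mem_dualitySet (x : E) {c : ℝ} :
    c • J x ∈ dualitySet (c • x) := by
  refine ⟨?_, ?_⟩
  · simp only [smul_apply, map_smul, smul_eq_mul, J_apply_self, norm_smul,
      Real.norm_eq_abs, mul_pow, sq_abs]
    ring
  · rw [norm_smul, norm_smul, norm_J]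

/-- At one fixed step `δ / 2` both functionals are within `ε / 3` of a difference quotient, and
these quotients depend on the base point in a Lipschitz way. -/
theorem norm_sub_le_of_mem_dualitySet (hE : UniformlySmooth E) {ε : ℝ} (hε : 0 < ε) :
    ∃ δ : ℝ, 0 < δ ∧ ∀ x y : E, ∀ ξ ∈ dualitySet x, ∀ η ∈ dualitySet y, ‖x‖ = 1 → ‖y‖ = 1 →
      ‖x - y‖ ≤ δ → ‖ξ - η‖ ≤ ε := by
  obtain ⟨δ, hδ, h⟩ := abs_quotient_sub_J_le hE (show 0 < ε / 3 by positivity)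
  refine ⟨ε / 3 * (δ / 2) / 2, by positivity, fun x y ξ hξ η hη hx hy hxy => ?_⟩
  have key : ∀ v : E, ‖v‖ = 1 → |(ξ - η) v| ≤ ε := by
    intro v hv
    have hpos : 0 < δ / 2 := by positivity
    have habs : |δ / 2| < δ := by rw [abs_of_pos hpos]; linarith
    have h1 := abs_le.1 (h x v ξ hξ hx hv (δ / 2) hpos.ne' habs)
    have h2 := abs_le.1 (h y v η hη hy hv (δ / 2) hpos.ne' habs)
    have h3 : |(‖x + (δ / 2) • v‖ - ‖x‖) / (δ / 2) - (‖y + (δ / 2) • v‖ - ‖y‖) / (δ / 2)|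
        ≤ ε / 3 := by
      rw [← sub_div, abs_div, abs_of_pos hpos, div_le_iff₀ hpos]
      have h4 : |‖x + (δ / 2) • v‖ - ‖y + (δ / 2) • v‖| ≤ ‖x - y‖ := by
        simpa using abs_norm_sub_norm_le (x + (δ / 2) • v) (y + (δ / 2) • v)
      rw [hx, hy, sub_sub_sub_cancel_right]
      have : 0 ≤ ε / 3 * (δ / 2) := by positivity
      linarith
    have h4 := abs_le.1 h3
    rw [sub_apply, abs_le]
    constructor <;> linarith
  refine ContinuousLinearMap.opNorm_le_bound _ hε.le fun v => ?_
  by_cases hv : v = 0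
  · simp [hv]
  have hv' : ‖v‖ ≠ 0 := norm_ne_zero_iff.2 hv
  have h1 := key (‖v‖⁻¹ • v) (by rw [norm_smul, norm_inv, norm_norm, inv_mul_cancel₀ hv'])
  rw [map_smul, smul_eq_mul, abs_mul, abs_inv, abs_norm, inv_mul_le_iff₀ (by positivity)] at h1
  rw [Real.norm_eq_abs]; linarith

/-- In a uniformly smooth space the duality map is uniformly continuous on bounded sets. -/
theorem norm_J_sub_J_le (hE : UniformlySmooth E) (M : ℝ) {ε : ℝ} (hε : 0 < ε) :
    ∃ δ : ℝ, 0 < δ ∧ ∀ x y : E, ‖x‖ ≤ M → ‖x - y‖ ≤ δ → ‖J x - J y‖ ≤ ε := by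
  obtain ⟨δ, hδ, h⟩ := norm_sub_le_of_mem_dualitySet hE (show 0 < ε / (2 * (|M| + 1)) by positivity)
  refine ⟨min (ε / 8) (δ * (ε / 4) / 2), by positivity, fun x y hxM hxy => ?_⟩
  have hxy1 : ‖x - y‖ ≤ ε / 8 := hxy.trans (min_le_left _ _)
  have hxy2 : ‖x - y‖ ≤ δ * (ε / 4) / 2 := hxy.trans (min_le_right _ _)
  have hdiff := abs_le.1 ((abs_norm_sub_norm_le x y).trans hxy1)
  -- Near the origin the triangle inequality suffices; away from it both points can be normalized.
  rcases le_or_gt ‖x‖ (ε / 4) with hx | hx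
  · calc ‖J x - J y‖ ≤ ‖J x‖ + ‖J y‖ := norm_sub_le _ _
      _ = ‖x‖ + ‖y‖ := by rw [norm_J, norm_J]
      _ ≤ ε := by linarith
  have hx0 : 0 < ‖x‖ := by linarith
  have hy0 : 0 < ‖y‖ := by linarith
  have hxu : ‖‖x‖⁻¹ • x‖ = 1 := by rw [norm_smul, norm_inv, norm_norm, inv_mul_cancel₀ hx0.ne']
  have hyu : ‖‖y‖⁻¹ • y‖ = 1 := by rw [norm_smul, norm_inv, norm_norm, inv_mul_cancel₀ hy0.ne']
  have hclose : ‖‖x‖⁻¹ • x - ‖y‖⁻¹ • y‖ ≤ δ := by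
    have e1 : ‖x‖⁻¹ • x - ‖y‖⁻¹ • y = ‖x‖⁻¹ • (x - y) + (‖x‖⁻¹ * (‖y‖ - ‖x‖)) • (‖y‖⁻¹ • y) := by
      rw [smul_sub, smul_smul, mul_sub, inv_mul_cancel₀ hx0.ne', sub_mul, mul_assoc,
        mul_inv_cancel₀ hy0.ne', sub_smul]
      simp
    have e2 : ‖‖x‖⁻¹ • x - ‖y‖⁻¹ • y‖ ≤ ‖x‖⁻¹ * ‖x - y‖ + ‖x‖⁻¹ * ‖x - y‖ := by
      rw [e1]
      refine (norm_add_le _ _).trans (add_le_add ?_ ?_)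
      · rw [norm_smul, norm_inv, norm_norm]
      · rw [norm_smul, hyu, mul_one, norm_mul, norm_inv, norm_norm]
        gcongr
        rw [Real.norm_eq_abs, norm_sub_rev]
        exact abs_norm_sub_norm_le y x
    refine e2.trans ?_
    rw [← mul_add, inv_mul_le_iff₀ hx0]
    nlinarith
  have h1 := h _ _ _ (smul_J_mem_dualitySet x) _ (smul_J_mem_dualitySet y) hxu hyu hclose
  have e3 : J x - J y = ‖x‖ • (‖x‖⁻¹ • J x - ‖y‖⁻¹ • J y) + (‖x‖ - ‖y‖) • (‖y‖⁻¹ • J y) := by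
    ext w
    simp only [sub_apply, add_apply, smul_apply, smul_eq_mul]
    field_simp
    ring
  have hJy : ‖‖y‖⁻¹ • J y‖ = 1 := by
    rw [norm_smul, norm_inv, norm_norm, norm_J, inv_mul_cancel₀ hy0.ne']
  calc ‖J x - J y‖ ≤ ‖x‖ * ‖‖x‖⁻¹ • J x - ‖y‖⁻¹ • J y‖ + |‖x‖ - ‖y‖| * 1 := by
        rw [e3]
        refine (norm_add_le _ _).trans (add_le_add ?_ ?_)
        · rw [norm_smul, norm_norm]
        · rw [norm_smul, hJy, Real.norm_eq_abs]
    _ ≤ (|M| + 1) * (ε / (2 * (|M| + 1))) + ε / 8 * 1 := by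
        gcongr
        · exact hxM.trans ((le_abs_self M).trans (by linarith))
        · exact (abs_norm_sub_norm_le x y).trans hxy1
    _ ≤ ε := by
        have : (|M| + 1) * (ε / (2 * (|M| + 1))) = ε / 2 := by
          have : |M| + 1 ≠ 0 := by positivity
          field_simp
        rw [this]; linarith

theorem tendsto_J_sub_J (hE : UniformlySmooth E) {u v : ℕ → E} {M : ℝ} (hu : ∀ n, ‖u n‖ ≤ M)
    (h : Tendsto (fun n => u n - v n) atTop (𝓝 0)) :
    Tendsto (fun n => J (u n) - J (v n)) atTop (𝓝 0) := by
  rw [Metric.tendsto_atTop] at h ⊢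
  intro ε hε
  obtain ⟨δ, hδ, hJ⟩ := norm_J_sub_J_le (E := E) hE M (half_pos hε)
  obtain ⟨N, hN⟩ := h δ hδ
  refine ⟨N, fun n hn => ?_⟩
  have h1 := hN n hn
  rw [dist_zero_right] at h1 ⊢
  have := hJ (u n) (v n) (hu n) h1.le
  linarith

theorem continuous_J (hE : UniformlySmooth E) : Continuous (J : E → StrongDual ℝ E) := by
  rw [continuous_iff_continuousAt]
  intro x
  rw [Metric.continuousAt_iff]
  intro ε hε
  obtain ⟨δ, hδ, hJ⟩ := norm_J_sub_J_le (E := E) hE ‖x‖ (half_pos hε)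
  refine ⟨δ, hδ, fun {y} hy => ?_⟩
  rw [dist_comm, dist_eq_norm] at hy ⊢
  have := hJ x y le_rfl hy.le
  linarith

theorem continuous_J_line (hE : UniformlySmooth E) (x v w : E) :
    Continuous fun s : ℝ => J (x + s • v) w :=
  ((continuous_J hE).comp (by fun_prop : Continuous fun s : ℝ => x + s • v)).clm_apply
    continuous_const

/-- An inequality between a real number and a directional derivative of `‖·‖² / 2`, obtained from
the corresponding inequalities for increments. -/
theorem le_J_of_forall_increment (hE : UniformlySmooth E) (x v : E) (c : ℝ)
    (h : ∀ s : ℝ, 0 < s → s ≤ 1 → 2 * (s * c) ≤ ‖x + s • v‖ ^ 2 - ‖x‖ ^ 2) : c ≤ J x v := by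
  have hlim : Tendsto (fun s : ℝ => J (x + s • v) v) (𝓝[>] 0) (𝓝 (J x v)) := by
    have := (continuous_J_line hE x v v).tendsto 0
    simp only [zero_smul, add_zero] at this
    exact this.mono_left nhdsWithin_le_nhds
  refine ge_of_tendsto hlim ?_
  filter_upwards [Ioc_mem_nhdsGT (zero_lt_one' ℝ)] with s hs
  -- The subgradient is taken at the moved point, which bounds the increment from above; continuity
  -- of `J` then allows `s → 0`.
  have h1 := two_mul_J_sub_le (x + s • v) x
  have h2 := h s hs.1 hs.2
  have h3 : x - (x + s • v) = -(s • v) := by abel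
  rw [h3, map_neg, map_smul, smul_eq_mul] at h1
  have h4 : s * c ≤ s * J (x + s • v) v := by linarith
  exact le_of_mul_le_mul_left h4 hs.1

end DualityMap

/-! ### Uniform convexity: small `φ` means small distance, and nested convex sets meet. -/

section UniformConvexity

variable {E : Type*} [NormedAddCommGroup E] [NormedSpace ℝ E]

/-- The squared norm of a uniformly convex space is uniformly convex on bounded sets. -/
theorem norm_half_add_sq_le [UniformConvexSpace E] (M : ℝ) {ε : ℝ} (hε : 0 < ε) :
    ∃ δ : ℝ, 0 < δ ∧ ∀ x y : E, ‖x‖ ≤ M → ‖y‖ ≤ M → ε ≤ ‖x - y‖ →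
      ‖(1 / 2 : ℝ) • (x + y)‖ ^ 2 ≤ (‖x‖ ^ 2 + ‖y‖ ^ 2) / 2 - δ := by
  obtain ⟨δ₀, hδ₀, h⟩ := exists_forall_closed_ball_dist_add_le_two_sub E
    (show 0 < ε / (|M| + 1) by positivity)
  obtain ⟨d, hd, hd₀, hd1⟩ : ∃ d : ℝ, 0 < d ∧ d ≤ δ₀ ∧ d ≤ 1 :=
    ⟨min δ₀ 1, by positivity, min_le_left _ _, min_le_right _ _⟩
  refine ⟨min ((ε * d / 16) ^ 2 / 4) ((ε / 2) * (ε * d / 8)), by positivity, ?_⟩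
  suffices key : ∀ x y : E, ‖y‖ ≤ ‖x‖ → ‖x‖ ≤ M → ε ≤ ‖x - y‖ →
      ‖(1 / 2 : ℝ) • (x + y)‖ ^ 2 ≤ (‖x‖ ^ 2 + ‖y‖ ^ 2) / 2 -
        min ((ε * d / 16) ^ 2 / 4) ((ε / 2) * (ε * d / 8)) by
    intro x y hx hy hxy
    rcases le_total ‖y‖ ‖x‖ with hle | hle
    · exact key x y hle hx hxy
    · rw [add_comm x y, add_comm (‖x‖ ^ 2)]
      exact key y x hle hy (by rwa [norm_sub_rev])
  intro x y hle hx hxy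
  have hR : ε / 2 ≤ ‖x‖ := by
    have := norm_sub_le x y
    linarith
  have hR0 : 0 < ‖x‖ := by linarith
  have hRM : ‖x‖ ≤ |M| + 1 := hx.trans ((le_abs_self M).trans (by linarith))
  have hhalf : ‖(1 / 2 : ℝ) • (x + y)‖ = ‖x + y‖ / 2 := by
    rw [norm_smul, Real.norm_of_nonneg (by norm_num)]; ring
  have hmid : ‖x + y‖ ≤ (2 - d) * ‖x‖ := by
    have h1 : ‖‖x‖⁻¹ • x‖ ≤ 1 := by rw [norm_smul, norm_inv, norm_norm, inv_mul_cancel₀ hR0.ne']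
    have h2 : ‖‖x‖⁻¹ • y‖ ≤ 1 := by
      rw [norm_smul, norm_inv, norm_norm, inv_mul_le_iff₀ hR0, mul_one]; exact hle
    have h3 : ε / (|M| + 1) ≤ ‖‖x‖⁻¹ • x - ‖x‖⁻¹ • y‖ := by
      rw [← smul_sub, norm_smul, norm_inv, norm_norm, ← div_eq_inv_mul]
      gcongr
    have h4 := h h1 h2 h3
    rw [← smul_add, norm_smul, norm_inv, norm_norm, inv_mul_le_iff₀ hR0] at h4
    nlinarith
  have htri := norm_add_le x y
  have hxy0 := norm_nonneg (x + y)
  rw [hhalf]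
  -- If the norms differ noticeably, strict convexity of the square gives the gain `(‖x‖ - ‖y‖)² /
  -- 4`. Otherwise the gain comes from uniform convexity of the ball of radius `‖x‖ ≥ ε / 2`.
  rcases le_or_gt (ε * d / 16) (‖x‖ - ‖y‖) with he | he
  · have h1 : (ε * d / 16) ^ 2 ≤ (‖x‖ - ‖y‖) ^ 2 := by gcongr
    have h2 : ‖x + y‖ ^ 2 ≤ (‖x‖ + ‖y‖) ^ 2 := by gcongr
    have h3 := min_le_left ((ε * d / 16) ^ 2 / 4) ((ε / 2) * (ε * d / 8))
    nlinarith
  · have h3 := min_le_right ((ε * d / 16) ^ 2 / 4) ((ε / 2) * (ε * d / 8))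
    have h1 : ‖x + y‖ ^ 2 ≤ ((2 - d) * ‖x‖) ^ 2 := by gcongr
    have h2 : ‖x‖ ^ 2 * (d / 2) - 2 * ‖x‖ * (ε * d / 16) ≤
        (‖x‖ ^ 2 + ‖y‖ ^ 2) / 2 - (‖x + y‖ / 2) ^ 2 := by
      have h5 : d ^ 2 * ‖x‖ ^ 2 ≤ d * ‖x‖ ^ 2 := by
        gcongr; nlinarith
      have h6 : ‖x‖ * (‖x‖ - ‖y‖) ≤ ‖x‖ * (ε * d / 16) := by gcongr
      nlinarith [sq_nonneg (‖x‖ - ‖y‖), mul_pos hR0 (mul_pos hε hd)]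
    have h4 : (ε / 2) * (ε * d / 8) ≤ ‖x‖ ^ 2 * (d / 2) - 2 * ‖x‖ * (ε * d / 16) := by
      have : ‖x‖ ^ 2 * (d / 2) - 2 * ‖x‖ * (ε * d / 16) = (‖x‖ * d / 2) * (‖x‖ - ε / 4) := by ring
      rw [this]
      have h7 : ε / 4 ≤ ‖x‖ - ε / 4 := by linarith
      calc ε / 2 * (ε * d / 8) = (ε / 2 * d / 2) * (ε / 4) := by ring
        _ ≤ (‖x‖ * d / 2) * (‖x‖ - ε / 4) := by gcongr
    linarith

theorem phi_nonneg (x y : E) : 0 ≤ phi x y := by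
  have := J_apply_le y x
  unfold phi
  nlinarith [sq_nonneg (‖x‖ - ‖y‖)]

theorem sq_norm_sub_norm_le_phi (x y : E) : (‖x‖ - ‖y‖) ^ 2 ≤ phi x y := by
  have := J_apply_le y x
  unfold phi
  nlinarith

theorem phi_self (x : E) : phi x x = 0 := by
  unfold phi; rw [J_apply_self]; ring

/-- The three point identity. -/
theorem phi_three_point (x y z : E) :
    phi x z = phi x y + phi y z + 2 * (J y - J z) (x - y) := by
  unfold phi
  simp only [sub_apply, map_sub, J_apply_self]
  ring

/-- The left side is just `J y x`, and the subgradient inequality at `y` is tested at the midpoint.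
With uniform convexity this bounds the distance by `φ`. -/
theorem norm_half_add_sq_ge (x y : E) :
    (‖x‖ ^ 2 + ‖y‖ ^ 2) / 2 - phi x y / 2 ≤ ‖(1 / 2 : ℝ) • (x + y)‖ ^ 2 := by
  have h := two_mul_J_sub_le y ((1 / 2 : ℝ) • (x + y))
  rw [map_sub, map_smul, map_add, J_apply_self, smul_eq_mul] at h
  unfold phi
  linarith

variable [UniformConvexSpace E]

theorem norm_sub_lt_of_phi_lt (M : ℝ) {ε : ℝ} (hε : 0 < ε) :
    ∃ δ : ℝ, 0 < δ ∧ ∀ x y : E, ‖x‖ ≤ M → ‖y‖ ≤ M → phi x y < δ → ‖x - y‖ < ε := by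
  obtain ⟨δ, hδ, h⟩ := norm_half_add_sq_le (E := E) M hε
  refine ⟨2 * δ, by positivity, fun x y hx hy hxy => ?_⟩
  by_contra! hcon
  have h1 := h x y hx hy hcon
  have h2 := norm_half_add_sq_ge x y
  linarith

theorem eq_of_phi_nonpos {x y : E} (h : phi x y ≤ 0) : x = y := by
  refine eq_of_forall_dist_le fun ε hε => ?_
  obtain ⟨δ, hδ, hφ⟩ := norm_sub_lt_of_phi_lt (E := E) (max ‖x‖ ‖y‖) hε
  rw [dist_eq_norm]
  exact (hφ x y (le_max_left _ _) (le_max_right _ _) (h.trans_lt hδ)).le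

theorem tendsto_sub_of_tendsto_phi {u v : ℕ → E} {M : ℝ} (hu : ∀ n, ‖u n‖ ≤ M)
    (hv : ∀ n, ‖v n‖ ≤ M) (h : Tendsto (fun n => phi (u n) (v n)) atTop (𝓝 0)) :
    Tendsto (fun n => u n - v n) atTop (𝓝 0) := by
  rw [Metric.tendsto_atTop]
  intro ε hε
  obtain ⟨δ, hδ, hφ⟩ := norm_sub_lt_of_phi_lt (E := E) M hε
  obtain ⟨N, hN⟩ := eventually_atTop.1 (h.eventually (gt_mem_nhds hδ))
  refine ⟨N, fun n hn => ?_⟩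
  rw [dist_zero_right]
  exact hφ _ _ (hu n) (hv n) (hN n hn)

/-- A decreasing sequence of nonempty closed convex sets, the first of which is bounded, has a
common point. -/
theorem exists_mem_iInter_of_antitone [CompleteSpace E] {A : ℕ → Set E} (hA : Antitone A)
    (hne : ∀ n, (A n).Nonempty) (hcl : ∀ n, IsClosed (A n)) (hco : ∀ n, Convex ℝ (A n)) {M : ℝ}
    (hM : ∀ x ∈ A 0, ‖x‖ ≤ M) : ∃ p, ∀ n, p ∈ A n := by
  -- Almost minimal-norm points of `A n` form a Cauchy sequence, since midpoints stay in the larger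
  -- set and cannot beat its infimum.
  set σ : ℕ → ℝ := fun n => sInf ((fun x : E => ‖x‖ ^ 2) '' A n) with hσ
  have hbdd : ∀ n, BddBelow ((fun x : E => ‖x‖ ^ 2) '' A n) := fun n =>
    ⟨0, by rintro _ ⟨x, -, rfl⟩; positivity⟩
  have hσle : ∀ n, ∀ x ∈ A n, σ n ≤ ‖x‖ ^ 2 := fun n x hx => csInf_le (hbdd n) ⟨x, hx, rfl⟩
  have hmono : Monotone σ := fun m n hmn =>
    csInf_le_csInf (hbdd m) ((hne n).image _) (Set.image_mono (hA hmn))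
  have hMn : ∀ n, ∀ x ∈ A n, ‖x‖ ≤ M := fun n x hx => hM x (hA (Nat.zero_le n) hx)
  have hbd : BddAbove (Set.range σ) := by
    refine ⟨M ^ 2, ?_⟩
    rintro _ ⟨n, rfl⟩
    obtain ⟨x, hx⟩ := hne n
    refine (hσle n x hx).trans ?_
    have := hMn n x hx
    gcongr
  obtain ⟨l, hl⟩ : ∃ l, Tendsto σ atTop (𝓝 l) := ⟨_, tendsto_atTop_ciSup hmono hbd⟩
  have hσl : ∀ n, σ n ≤ l := fun n => hmono.ge_of_tendsto hl n
  have hex : ∀ n : ℕ, ∃ x ∈ A n, ‖x‖ ^ 2 < σ n + 1 / ((n : ℝ) + 1) := by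
    intro n
    obtain ⟨_, ⟨x, hx, rfl⟩, hlt⟩ := exists_lt_of_csInf_lt ((hne n).image fun x : E => ‖x‖ ^ 2)
      (show σ n < σ n + 1 / ((n : ℝ) + 1) by
        have : 0 < 1 / ((n : ℝ) + 1) := by positivity
        linarith)
    exact ⟨x, hx, hlt⟩
  choose a ha hσa using hex
  have hcauchy : CauchySeq a := by
    rw [Metric.cauchySeq_iff']
    intro ε hε
    obtain ⟨δ, hδ, hUC⟩ := norm_half_add_sq_le (E := E) M hε
    have hlim : Tendsto (fun n : ℕ => l - σ n + 1 / ((n : ℝ) + 1)) atTop (𝓝 0) := by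
      simpa using (hl.const_sub l).add tendsto_one_div_add_atTop_nhds_zero_nat
    obtain ⟨N, hN⟩ := eventually_atTop.1 (hlim.eventually (gt_mem_nhds hδ))
    refine ⟨N, fun n hn => ?_⟩
    rw [dist_eq_norm]
    by_contra! hcon
    have h1 := hUC _ _ (hMn n _ (ha n)) (hMn N _ (ha N)) hcon
    have hmem : (1 / 2 : ℝ) • (a n + a N) ∈ A N := by
      rw [smul_add]
      exact hco N (hA hn (ha n)) (ha N) (by norm_num) (by norm_num) (by norm_num)
    have h2 := hσle N _ hmem
    have h3 := hσa n
    have h4 := hσa N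
    have h5 : 1 / ((n : ℝ) + 1) ≤ 1 / ((N : ℝ) + 1) := by gcongr
    have h6 := hN N le_rfl
    have h7 := hσl n
    have h8 := hσl N
    linarith
  obtain ⟨p, hp⟩ := cauchySeq_tendsto_of_complete hcauchy
  exact ⟨p, fun n => (hcl n).mem_of_tendsto hp
    (eventually_atTop.2 ⟨n, fun m hm => hA hm (ha m)⟩)⟩

end UniformConvexity

/-! ### Weak limits and weak sequential compactness. -/

section WeakCompactness

variable {E : Type*} [NormedAddCommGroup E] [NormedSpace ℝ E]

theorem mem_of_weaklyConverges {C : Set E} (hC : IsClosed C) (hC' : Convex ℝ C) {u : ℕ → E} {p : E}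
    (hu : ∀ n, u n ∈ C) (h : WeaklyConverges u p) : p ∈ C := by
  by_contra hp
  obtain ⟨ξ, c, hc, hcp⟩ := geometric_hahn_banach_closed_point hC' hC hp
  exact (le_of_tendsto (h ξ) (Eventually.of_forall fun n => (hc _ (hu n)).le)).not_gt hcp

theorem WeaklyConverges.of_tendsto_sub {u v : ℕ → E} {p : E} (hu : WeaklyConverges u p)
    (h : Tendsto (fun n => v n - u n) atTop (𝓝 0)) : WeaklyConverges v p := by
  intro ξ
  have h1 := (hu ξ).add ((ξ.continuous.tendsto 0).comp h)
  simpa [Function.comp_def] using h1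

/-- Weak lower semicontinuity of the distance to a point. -/
theorem WeaklyConverges.norm_sub_le {u : ℕ → E} {p : E} (hu : WeaklyConverges u p) {q : E} {r : ℝ}
    (h : ∀ᶠ n in atTop, ‖q - u n‖ ≤ r) : ‖q - p‖ ≤ r := by
  obtain ⟨g, hg, hgp⟩ := exists_dual_vector'' ℝ (q - p)
  have h1 : Tendsto (fun n => g (q - u n)) atTop (𝓝 (g (q - p))) := by
    simpa only [map_sub] using (hu g).const_sub (g q)
  rw [hgp] at h1
  refine le_of_tendsto h1 ?_
  filter_upwards [h] with n hn
  calc g (q - u n) ≤ ‖g‖ * ‖q - u n‖ := (le_abs_self _).trans (g.le_opNorm _)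
    _ ≤ 1 * ‖q - u n‖ := by gcongr
    _ ≤ r := by rwa [one_mul]

variable [CompleteSpace E] [UniformConvexSpace E]

/-- Every functional agrees on a closed subspace with the duality map at a point of the subspace. -/
theorem exists_eq_J_on_submodule (hE : UniformlySmooth E) (Y : Submodule ℝ E)
    (hY : IsClosed (Y : Set E)) (ξ : StrongDual ℝ E) : ∃ y ∈ Y, ∀ v ∈ Y, ξ v = J y v := by
  -- The point sought minimizes `g` over `Y`: the first-order condition in the directions `v` and
  -- `-v` is the claimed equality.
  set g : E → ℝ := fun y => ‖y‖ ^ 2 - 2 * ξ y with hg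
  have hlow : ∀ y, (‖y‖ - ‖ξ‖) ^ 2 - ‖ξ‖ ^ 2 ≤ g y := by
    intro y
    have := (le_abs_self _).trans (ξ.le_opNorm y)
    simp only [hg]
    nlinarith
  have hbdd : BddBelow (g '' Y) := by
    refine ⟨-‖ξ‖ ^ 2, ?_⟩
    rintro _ ⟨y, -, rfl⟩
    nlinarith [hlow y, sq_nonneg (‖y‖ - ‖ξ‖)]
  set m := sInf (g '' Y) with hm
  have hgcont : Continuous g := by fun_prop
  have hgconv : ConvexOn ℝ (Y : Set E) g := by
    have h1 : ConvexOn ℝ (Y : Set E) fun y : E => ‖y‖ ^ 2 :=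
      (convexOn_norm Y.convex).pow (fun _ _ => norm_nonneg _) 2
    have h2 : ConcaveOn ℝ (Y : Set E) fun y : E => 2 * ξ y :=
      ((2 : ℝ) • ξ).toLinearMap.concaveOn Y.convex
    exact h1.sub h2
  obtain ⟨p, hp⟩ : ∃ p, ∀ n : ℕ, p ∈ {y | y ∈ (Y : Set E) ∧ g y ≤ m + 1 / ((n : ℝ) + 1)} := by
    refine exists_mem_iInter_of_antitone (M := ‖ξ‖ + (m + 1 + ‖ξ‖ ^ 2 + 1)) ?_ ?_ ?_ ?_ ?_
    · intro k n hkn y hy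
      refine ⟨hy.1, hy.2.trans ?_⟩
      gcongr
    · intro n
      obtain ⟨_, ⟨y, hy, rfl⟩, hlt⟩ := exists_lt_of_csInf_lt (⟨_, 0, Y.zero_mem, rfl⟩ :
        (g '' (Y : Set E)).Nonempty) (show m < m + 1 / ((n : ℝ) + 1) by
          have : 0 < 1 / ((n : ℝ) + 1) := by positivity
          linarith)
      exact ⟨y, hy, hlt.le⟩
    · exact fun n => hY.inter (isClosed_le hgcont continuous_const)
    · exact fun n => hgconv.convex_le _
    · rintro y ⟨-, hy⟩
      have h1 := hlow y
      norm_num at hy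
      nlinarith [sq_nonneg (‖y‖ - ‖ξ‖ - 1)]
  have hpY : p ∈ Y := (hp 0).1
  have hpm : g p ≤ m := by
    have h1 : Tendsto (fun n : ℕ => m + 1 / ((n : ℝ) + 1)) atTop (𝓝 m) := by
      simpa using tendsto_one_div_add_atTop_nhds_zero_nat.const_add m
    exact ge_of_tendsto' h1 fun n => (hp n).2
  have hle : ∀ v ∈ Y, ξ v ≤ J p v := by
    intro v hv
    refine le_J_of_forall_increment hE p v _ fun s _ _ => ?_
    have h1 : m ≤ g (p + s • v) :=
      csInf_le hbdd ⟨_, Y.add_mem hpY (Y.smul_mem s hv), rfl⟩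
    have h2 := hpm.trans h1
    simp only [hg, map_add, map_smul, smul_eq_mul] at h2
    linarith
  refine ⟨p, hpY, fun v hv => le_antisymm (hle v hv) ?_⟩
  have := hle (-v) (Y.neg_mem hv)
  rw [map_neg, map_neg] at this
  linarith

/-- Bounded sequences in a uniformly convex and uniformly smooth Banach space have weakly
convergent subsequences. -/
theorem exists_weaklyConverges_subseq (hE : UniformlySmooth E) {x : ℕ → E} {M : ℝ}
    (hM : ∀ n, ‖x n‖ ≤ M) : ∃ p, ∃ k : ℕ → ℕ, StrictMono k ∧ WeaklyConverges (x ∘ k) p := by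
  have hM0 : 0 ≤ M := (norm_nonneg _).trans (hM 0)
  set Y : Submodule ℝ E := (Submodule.span ℝ (Set.range x)).topologicalClosure with hY
  have hYcl : IsClosed (Y : Set E) := Submodule.isClosed_topologicalClosure _
  have hxY : ∀ n, x n ∈ Y := fun n =>
    Submodule.le_topologicalClosure _ (Submodule.subset_span ⟨n, rfl⟩)
  have hsep : TopologicalSpace.IsSeparable (Y : Set E) := by
    rw [hY, Submodule.topologicalClosure_coe]
    exact ((Set.countable_range x).isSeparable.span).closure
  have : TopologicalSpace.SeparableSpace Y := hsep.separableSpace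
  obtain ⟨d, hd⟩ := TopologicalSpace.exists_dense_seq Y
  -- A subsequence is chosen along which countably many functionals `J (d i)` converge. By
  -- `exists_eq_J_on_submodule` and norm continuity of `J`, these approximate every functional on
  -- `Y`.
  have hcomp : IsCompact (Set.univ.pi fun i : ℕ =>
      Set.Icc (-(‖(d i : E)‖ * M)) (‖(d i : E)‖ * M)) :=
    isCompact_univ_pi fun i => isCompact_Icc
  obtain ⟨l, -, k, hk, hl⟩ := hcomp.tendsto_subseq (x := fun n i => J (d i : E) (x n)) (by
    intro n i _
    refine abs_le.1 (((J (d i : E)).le_opNorm (x n)).trans ?_)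
    rw [norm_J]
    gcongr
    exact hM n)
  rw [tendsto_pi_nhds] at hl
  have hlim : ∀ ξ : StrongDual ℝ E, ∃ c, Tendsto (fun n => ξ (x (k n))) atTop (𝓝 c) := by
    intro ξ
    obtain ⟨y, hyY, hy⟩ := exists_eq_J_on_submodule hE Y hYcl ξ
    refine cauchySeq_tendsto_of_complete ?_
    rw [Metric.cauchySeq_iff']
    intro ε hε
    have hη : 0 < ε / (4 * (M + 1)) := by positivity
    have hopen : IsOpen {v : Y | dist (J (v : E)) (J y) < ε / (4 * (M + 1))} :=
      isOpen_lt (((continuous_J hE).comp continuous_subtype_val).dist continuous_const)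
        continuous_const
    obtain ⟨i, hi⟩ := hd.exists_mem_open hopen ⟨⟨y, hyY⟩, by simpa using hη⟩
    have happrox : ∀ n, |J (d i : E) (x n) - ξ (x n)| ≤ ε / 4 := by
      intro n
      rw [hy _ (hxY n), ← sub_apply]
      calc |(J (d i : E) - J y) (x n)| ≤ ‖J (d i : E) - J y‖ * ‖x n‖ :=
            (J (d i : E) - J y).le_opNorm (x n)
        _ ≤ ε / (4 * (M + 1)) * (M + 1) := by
            gcongr
            · rw [← dist_eq_norm]; exact le_of_lt hi
            · linarith [hM n]
        _ = ε / 4 := by field_simp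
    obtain ⟨N, hN⟩ := Metric.cauchySeq_iff'.1 (hl i).cauchySeq (ε / 2) (by positivity)
    refine ⟨N, fun n hn => ?_⟩
    have h1 := hN n hn
    have h2 := abs_le.1 (happrox (k n))
    have h3 := abs_le.1 (happrox (k N))
    rw [Real.dist_eq, abs_lt] at h1 ⊢
    simp only [Function.comp_apply] at h1
    constructor <;> linarith [h1.1, h1.2]
  -- The weak limit is a common point of the closed convex hulls of the tails, since every `ξ` maps
  -- late hulls close to its limit `c`.
  obtain ⟨p, hp⟩ := exists_mem_iInter_of_antitone
    (A := fun n : ℕ => closure (convexHull ℝ (x ∘ k '' Set.Ici n))) (M := M)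
    (fun m n hmn => closure_mono (convexHull_mono (Set.image_mono (Set.Ici_subset_Ici.2 hmn))))
    (fun n => ⟨x (k n), subset_closure (subset_convexHull ℝ _ ⟨n, Set.self_mem_Ici, rfl⟩)⟩)
    (fun n => isClosed_closure) (fun n => (convex_convexHull ℝ _).closure) (by
      intro y hy
      have hsub : closure (convexHull ℝ (x ∘ k '' Set.Ici 0)) ⊆ Metric.closedBall (0 : E) M :=
        closure_minimal (convexHull_min (by
          rintro _ ⟨n, -, rfl⟩
          simpa using hM (k n)) (convex_closedBall _ _)) Metric.isClosed_closedBall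
      simpa using hsub hy)
  refine ⟨p, k, hk, fun ξ => ?_⟩
  obtain ⟨c, hc⟩ := hlim ξ
  suffices ξ p = c by rw [this]; exact hc
  refine eq_of_forall_dist_le fun ε hε => ?_
  obtain ⟨N, hN⟩ := Metric.tendsto_atTop.1 hc ε hε
  have hsub : closure (convexHull ℝ (x ∘ k '' Set.Ici N)) ⊆ ξ ⁻¹' Metric.closedBall c ε :=
    closure_minimal (convexHull_min (by
      rintro _ ⟨n, hn, rfl⟩
      exact (hN n hn).le) ((convex_closedBall c ε).linear_preimage ξ.toLinearMap))
      (Metric.isClosed_closedBall.preimage ξ.continuous)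
  exact hsub (hp N)

end WeakCompactness

/-! ### One step of the algorithm. -/

section Steps

variable {E : Type*} [NormedAddCommGroup E] [NormedSpace ℝ E]

theorem phi_add_phi_le_of_mem_cutD {C : Set E} {x₀ x v : E} (hv : v ∈ cutD C x₀ x) :
    phi x₀ x + phi x v ≤ phi x₀ v := by
  have h := phi_three_point x₀ x v
  have h' := hv.2
  linarith

/-- The variational inequality of a sunny generalized nonexpansive retraction. -/
theorem SunnyGeneralizedNonexpansiveRetraction.variational_inequality (hE : UniformlySmooth E)
    {R : E → E} {D : Set E} (hR : SunnyGeneralizedNonexpansiveRetraction R D) (x : E) {v : E}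
    (hv : v ∈ D) : 0 ≤ (J (R x) - J v) (x - R x) := by
  rw [sub_apply, sub_nonneg]
  refine le_J_of_forall_increment hE _ _ _ fun s hs _ => ?_
  have h := hR.phi_le (R x + s • (x - R x)) v hv
  rw [hR.sunny x s hs.le] at h
  unfold phi at h
  rw [map_add, map_smul, smul_eq_mul] at h
  linarith

/-- The variational inequality of a proximal step. -/
theorem IsArgminOn.variational_inequality (hE : UniformlySmooth E) {C : Set E} {g : E → ℝ}
    (hg : ConvexOn ℝ C g) {l : ℝ} (hl : 0 ≤ l) {x p v : E}
    (hp : IsArgminOn (fun v => l * g v + (1 / 2) * phi v x) C p) (hv : v ∈ C) :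
    (J x - J p) (v - p) ≤ l * (g v - g p) := by
  suffices J x (v - p) - l * (g v - g p) ≤ J p (v - p) by
    rw [sub_apply]; linarith
  refine le_J_of_forall_increment hE _ _ _ fun s hs hs1 => ?_
  have hw : p + s • (v - p) = (1 - s) • p + s • v := by
    rw [smul_sub, sub_smul, one_smul]; abel
  have hwC : p + s • (v - p) ∈ C := by
    rw [hw]; exact hg.1 hp.1 hv (by linarith) hs.le (by ring)
  have h1 : g (p + s • (v - p)) ≤ (1 - s) * g p + s * g v := by
    rw [hw]; exact hg.2 hp.1 hv (by linarith) hs.le (by ring)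
  have h2 : l * g p + 1 / 2 * phi p x ≤
      l * g (p + s • (v - p)) + 1 / 2 * phi (p + s • (v - p)) x := hp.2 _ hwC
  have h3 := mul_le_mul_of_nonneg_left h1 hl
  unfold phi at h2
  rw [map_add, map_smul, smul_eq_mul] at h2
  nlinarith

/-- The step for `z` is tested at `u` and the step for `y` at `z`. Pseudomonotonicity discards `f y
u`, (A5) bounds the remaining values of `f`, and two three-point identities convert the pairings
into `φ`. -/
theorem extragradient_phi_le (hE : UniformlySmooth E) {C : Set E} {f : E → E → ℝ} {c₁ c₂ l : ℝ}
    (hA2 : CondA2 C f) (hA4 : CondA4 C f) (hA5 : CondA5 C f c₁ c₂) (hl : 0 ≤ l) {x y z u : E}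
    (hx : x ∈ C) (hy : IsArgminOn (fun v => l * f x v + (1 / 2) * phi v x) C y)
    (hz : IsArgminOn (fun v => l * f y v + (1 / 2) * phi v x) C z) (hu : u ∈ equilibriumSet C f) :
    phi u z + ((1 - 2 * (l * c₁)) * phi y x + (1 - 2 * (l * c₂)) * phi z y) ≤ phi u x := by
  have h1 := hz.variational_inequality hE (hA4 y hy.1).1 hl hu.1
  have h2 := hy.variational_inequality hE (hA4 x hx).1 hl hz.1
  have h3 : f y u ≤ 0 := hA2 u hu.1 y hy.1 (hu.2 y hy.1)
  have h4 := hA5 x hx y hy.1 z hz.1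
  have h5 := phi_three_point u z x
  have h6 := phi_three_point z y x
  have h7 := mul_nonneg hl (sub_nonneg.2 h4)
  have h8 := mul_nonneg hl (neg_nonneg.2 h3)
  simp only [sub_apply] at *
  nlinarith

/-- An exact identity, obtained by evaluating `J t` at both `p` and `t`; the usual convexity
estimate would lose the term `α φ(t, x)` needed for strictness. -/
theorem phi_add_phi_of_J_eq {x z w t : E} {α β : ℝ}
    (ht : J t = α • J x + (1 - α) • (β • J z + (1 - β) • J w)) (p : E) :
    phi p t + (α * phi t x + (1 - α) * (β * phi t z + (1 - β) * phi t w)) =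
      α * phi p x + (1 - α) * (β * phi p z + (1 - β) * phi p w) := by
  have h1 : J t p = α * J x p + (1 - α) * (β * J z p + (1 - β) * J w p) := by
    rw [ht]; simp [mul_add]
  have h2 : ‖t‖ ^ 2 = α * J x t + (1 - α) * (β * J z t + (1 - β) * J w t) := by
    rw [← J_apply_self, ht]; simp [mul_add]
  unfold phi
  rw [h1]
  linear_combination 2 * h2

theorem phi_step_le (hE : UniformlySmooth E) {C : Set E} {f : E → E → ℝ} {S : E → E}
    {c₁ c₂ l α β : ℝ} (hA2 : CondA2 C f) (hA4 : CondA4 C f) (hA5 : CondA5 C f c₁ c₂)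
    (hS : RelativelyNonexpansive C S) (hl : 0 ≤ l) (hα : α ∈ Set.Icc (0 : ℝ) 1)
    (hβ : β ∈ Set.Icc (0 : ℝ) 1) {x y z t u : E} (hx : x ∈ C)
    (hy : IsArgminOn (fun v => l * f x v + (1 / 2) * phi v x) C y)
    (hz : IsArgminOn (fun v => l * f y v + (1 / 2) * phi v x) C z)
    (ht : J t = α • J x + (1 - α) • (β • J z + (1 - β) • J (S z)))
    (hu : u ∈ equilibriumSet C f ∩ fixedPoints C S) :
    phi u t + (α * phi t x +
      (1 - α) * ((1 - 2 * (l * c₁)) * phi y x + (1 - 2 * (l * c₂)) * phi z y)) ≤ phi u x := by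
  have h1 := extragradient_phi_le hE hA2 hA4 hA5 hl hx hy hz hu.1
  have h2 := hS.phi_le z hz.1 u hu.2
  have h3 := phi_add_phi_of_J_eq ht u
  have hα' : 0 ≤ 1 - α := sub_nonneg.2 hα.2
  have hβ' : 0 ≤ 1 - β := sub_nonneg.2 hβ.2
  have h4 : 0 ≤ (1 - α) * (β * phi t z + (1 - β) * phi t (S z)) :=
    mul_nonneg hα' (add_nonneg (mul_nonneg hβ.1 (phi_nonneg _ _)) (mul_nonneg hβ' (phi_nonneg _ _)))
  have h5 : β * phi u z + (1 - β) * phi u (S z) ≤ phi u z := by nlinarith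
  have h6 := mul_le_mul_of_nonneg_left h5 hα'
  have h7 := mul_le_mul_of_nonneg_left h1 hα'
  nlinarith

end Steps

/-! ### From weak to strong convergence. -/

section Convergence

variable {E : Type*} [NormedAddCommGroup E] [NormedSpace ℝ E]

theorem ExtragradientSequences.mem {C : Set E} {f : E → E → ℝ} {S : E → E} {α β lam : ℕ → ℝ}
    {x y z t : ℕ → E} (hseq : ExtragradientSequences C f S α β lam x y z t) : ∀ n, x n ∈ C
  | 0 => hseq.start
  | n + 1 => by
    obtain ⟨R, hR, hx⟩ := hseq.x_step n
    rw [hx]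
    exact (hR.mem _).1.1

theorem ExtragradientSequences.mem_cutD_succ (hE : UniformlySmooth E) {C : Set E} {f : E → E → ℝ}
    {S : E → E} {α β lam : ℕ → ℝ} {x y z t : ℕ → E}
    (hseq : ExtragradientSequences C f S α β lam x y z t) {n : ℕ} {v : E}
    (hv : v ∈ cutC C (t n) (x n) ∩ cutD C (x 0) (x n)) : v ∈ cutD C (x 0) (x (n + 1)) := by
  obtain ⟨R, hR, hx⟩ := hseq.x_step n
  refine ⟨hv.1.1, ?_⟩
  rw [hx]
  exact hR.variational_inequality hE _ hv

theorem ExtragradientSequences.succ_mem {C : Set E} {f : E → E → ℝ} {S : E → E} {α β lam : ℕ → ℝ}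
    {x y z t : ℕ → E} (hseq : ExtragradientSequences C f S α β lam x y z t) (n : ℕ) :
    x (n + 1) ∈ cutC C (t n) (x n) ∩ cutD C (x 0) (x n) := by
  obtain ⟨R, hR, hx⟩ := hseq.x_step n
  rw [hx]
  exact hR.mem _

theorem mem_cutD_self {C : Set E} {x₀ v : E} (hv : v ∈ C) : v ∈ cutD C x₀ x₀ :=
  ⟨hv, by simp⟩

theorem phi_sub_phi (v t x : E) :
    phi v t - phi v x = 2 * (J x - J t) v + (‖t‖ ^ 2 - ‖x‖ ^ 2) := by
  unfold phi; rw [sub_apply]; ring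

theorem tendsto_phi_of_tendsto_sub {u v : ℕ → E} {M : ℝ} (hu : ∀ n, ‖u n‖ ≤ M)
    (hv : ∀ n, ‖v n‖ ≤ M) (h : Tendsto (fun n => u n - v n) atTop (𝓝 0)) :
    Tendsto (fun n => phi (u n) (v n)) atTop (𝓝 0) := by
  have hM : 0 ≤ M := (norm_nonneg _).trans (hu 0)
  refine squeeze_zero (g := fun n => 4 * M * ‖u n - v n‖) (fun n => phi_nonneg _ _)
    (fun n => ?_) ?_
  · have h1 : phi (u n) (v n) = (‖u n‖ - ‖v n‖) * (‖u n‖ + ‖v n‖) - 2 * J (v n) (u n - v n) := by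
      unfold phi; rw [map_sub, J_apply_self]; ring
    have h2 := J_apply_le (v n) (-(u n - v n))
    rw [map_neg, norm_neg] at h2
    have h3 := norm_sub_norm_le (u n) (v n)
    have h4 := norm_nonneg (u n - v n)
    have h5 : ‖v n‖ * ‖u n - v n‖ ≤ M * ‖u n - v n‖ := by gcongr; exact hv n
    have h6 : (‖u n‖ - ‖v n‖) * (‖u n‖ + ‖v n‖) ≤ ‖u n - v n‖ * (M + M) := by
      gcongr
      · exact hu n
      · exact hv n
    linarith
  · simpa using (h.norm.const_mul (4 * M))

theorem norm_le_of_phi_le {x y : E} {c M : ℝ} (h : phi x y ≤ c) (hx : ‖x‖ ≤ M) :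
    ‖y‖ ≤ M + (c + 1) := by
  have h1 := sq_norm_sub_norm_le_phi x y
  nlinarith [sq_nonneg (‖x‖ - ‖y‖ + 1)]

theorem norm_le_of_phi_le' {x y : E} {c M : ℝ} (h : phi x y ≤ c) (hy : ‖y‖ ≤ M) :
    ‖x‖ ≤ M + (c + 1) := by
  have h1 := sq_norm_sub_norm_le_phi x y
  nlinarith [sq_nonneg (‖x‖ - ‖y‖ - 1)]

/-- If a weak cluster point of the iterates satisfies the defining inequality of every nontrivial
`cutC C (t n) (x n)` strictly, then the whole sequence converges strongly to it: each set in the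
construction of the iterates contains a tail of the weakly convergent subsequence. -/
theorem ExtragradientSequences.tendsto_of_weaklyConverges [UniformConvexSpace E]
    (hE : UniformlySmooth E) {C : Set E} {f : E → E → ℝ} {S : E → E} {α β lam : ℕ → ℝ}
    {x y z t : ℕ → E} (hseq : ExtragradientSequences C f S α β lam x y z t) {M L : ℝ}
    (hM : ∀ n, ‖x n‖ ≤ M) (hL : Tendsto (fun n => phi (x 0) (x n)) atTop (𝓝 L))
    (hLle : ∀ n, phi (x 0) (x n) ≤ L) {k : ℕ → ℕ} {p : E} (hp : WeaklyConverges (x ∘ k) p)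
    (hcut : ∀ n, phi p (t n) < phi p (x n) ∨ t n = x n) : Tendsto x atTop (𝓝 p) := by
  have hC : ∀ n, ∀ᶠ j in atTop, x (k j) ∈ cutC C (t n) (x n) := by
    intro n
    rcases hcut n with h | h
    · have h1 : Tendsto (fun j => phi (x (k j)) (t n) - phi (x (k j)) (x n)) atTop
          (𝓝 (phi p (t n) - phi p (x n))) := by
        simp only [phi_sub_phi]
        exact ((hp (J (x n) - J (t n))).const_mul 2).add_const _
      filter_upwards [h1.eventually (gt_mem_nhds (sub_neg.2 h))] with j hj
      exact ⟨hseq.mem _, (sub_neg.1 hj).le⟩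
    · exact Eventually.of_forall fun j => ⟨hseq.mem _, by rw [h]⟩
  have hD : ∀ n, ∀ᶠ j in atTop, x (k j) ∈ cutD C (x 0) (x n) := by
    intro n
    induction n with
    | zero => exact Eventually.of_forall fun j => mem_cutD_self (hseq.mem _)
    | succ n ih =>
      filter_upwards [ih, hC n] with j h1 h2
      exact hseq.mem_cutD_succ hE ⟨h2, h1⟩
  rw [Metric.tendsto_atTop]
  intro ε hε
  obtain ⟨δ, hδ, hφ⟩ := norm_sub_lt_of_phi_lt (E := E) M (half_pos hε)
  obtain ⟨N, hN⟩ := eventually_atTop.1 (hL.eventually (lt_mem_nhds (sub_lt_self L hδ)))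
  refine ⟨N, fun n hn => ?_⟩
  have h1 : ‖x n - p‖ ≤ ε / 2 := by
    refine hp.norm_sub_le ?_
    filter_upwards [hD n] with j hj
    refine (hφ _ _ (hM _) (hM _) ?_).le
    have h2 := phi_add_phi_le_of_mem_cutD hj
    have h3 := hLle (k j)
    have h4 := hN n hn
    linarith
  rw [dist_eq_norm]; linarith

end Convergence

/-! ### Boundedness and vanishing differences. -/

section AsymptoticRegularity

variable {E : Type*} [NormedAddCommGroup E]

theorem exists_norm_le_of_tendsto_sub {u v : ℕ → E} {M : ℝ} (hu : ∀ n, ‖u n‖ ≤ M)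
    (h : Tendsto (fun n => u n - v n) atTop (𝓝 0)) : ∃ M', ∀ n, ‖v n‖ ≤ M' := by
  obtain ⟨c, hc⟩ := h.norm.bddAbove_range
  refine ⟨M + c, fun n => ?_⟩
  have h1 := hc ⟨n, rfl⟩
  have h2 := norm_sub_norm_le (v n) (u n)
  rw [norm_sub_rev] at h2
  have h3 := hu n
  simp only at h1
  linarith

variable [NormedSpace ℝ E]

theorem ExtragradientSequences.solution_mem (hE : UniformlySmooth E) {C : Set E}
    {f : E → E → ℝ} {S : E → E} {α β lam : ℕ → ℝ} {x y z t : ℕ → E}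
    (hseq : ExtragradientSequences C f S α β lam x y z t) {u : E} (hu : u ∈ C)
    (hcut : ∀ n, phi u (t n) ≤ phi u (x n)) : ∀ n, u ∈ cutD C (x 0) (x n)
  | 0 => mem_cutD_self hu
  | n + 1 => hseq.mem_cutD_succ hE ⟨⟨hu, hcut n⟩, hseq.solution_mem hE hu hcut n⟩

variable [UniformConvexSpace E]

theorem tendsto_sub_of_tendsto_phi_left {u v : ℕ → E} {M : ℝ} (hu : ∀ n, ‖u n‖ ≤ M)
    (h : Tendsto (fun n => phi (u n) (v n)) atTop (𝓝 0)) :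
    Tendsto (fun n => u n - v n) atTop (𝓝 0) := by
  obtain ⟨c, hc⟩ := h.bddAbove_range
  have hv : ∀ n, ‖v n‖ ≤ M + (c + 1) := fun n => norm_le_of_phi_le (hc ⟨n, rfl⟩) (hu n)
  exact tendsto_sub_of_tendsto_phi (fun n => (hu n).trans (le_max_left _ _))
    (fun n => (hv n).trans (le_max_right M _)) h

theorem tendsto_sub_of_tendsto_phi_right {u v : ℕ → E} {M : ℝ} (hv : ∀ n, ‖v n‖ ≤ M)
    (h : Tendsto (fun n => phi (u n) (v n)) atTop (𝓝 0)) :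
    Tendsto (fun n => u n - v n) atTop (𝓝 0) := by
  obtain ⟨c, hc⟩ := h.bddAbove_range
  have hu : ∀ n, ‖u n‖ ≤ M + (c + 1) := fun n => norm_le_of_phi_le' (hc ⟨n, rfl⟩) (hv n)
  exact tendsto_sub_of_tendsto_phi (fun n => (hu n).trans (le_max_right M _))
    (fun n => (hv n).trans (le_max_left _ _)) h

/-- On bounded sets the inverse of the duality map is uniformly continuous. -/
theorem tendsto_sub_of_tendsto_J_sub_J {u v : ℕ → E} {M : ℝ} (hv : ∀ n, ‖v n‖ ≤ M)
    (h : Tendsto (fun n => J (u n) - J (v n)) atTop (𝓝 0)) :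
    Tendsto (fun n => u n - v n) atTop (𝓝 0) := by
  refine tendsto_sub_of_tendsto_phi_right hv ?_
  refine squeeze_zero
    (g := fun n => 2 * (‖J (u n) - J (v n)‖ * (‖J (u n) - J (v n)‖ + 2 * M)))
    (fun n => phi_nonneg _ _) (fun n => ?_) ?_
  · have h1 := phi_three_point (u n) (v n) (u n)
    rw [phi_self] at h1
    have h2 := (le_abs_self _).trans ((J (u n) - J (v n)).le_opNorm (u n - v n))
    have h3 : ‖u n - v n‖ ≤ ‖J (u n) - J (v n)‖ + 2 * M := by
      have h4 := norm_sub_le (u n) (v n)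
      have h5 := norm_sub_norm_le (J (u n)) (J (v n))
      rw [norm_J, norm_J] at h5
      have h6 := hv n
      linarith
    have h4 : ‖J (u n) - J (v n)‖ * ‖u n - v n‖ ≤
        ‖J (u n) - J (v n)‖ * (‖J (u n) - J (v n)‖ + 2 * M) := by gcongr
    have h5 := phi_nonneg (v n) (u n)
    simp only [sub_apply] at h1 h2
    linarith
  · simpa using (h.norm.mul (h.norm.add_const (2 * M))).const_mul 2

/-- If some point is never cut off, then the iterates are bounded, `φ(x₀, x n)` increases to a
limit, and `x n - t n → 0`. -/
theorem ExtragradientSequences.tendsto_sub_of_forall_phi_le (hE : UniformlySmooth E) {C : Set E}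
    {f : E → E → ℝ} {S : E → E} {α β lam : ℕ → ℝ} {x y z t : ℕ → E}
    (hseq : ExtragradientSequences C f S α β lam x y z t) {u : E} (hu : u ∈ C)
    (hcut : ∀ n, phi u (t n) ≤ phi u (x n)) :
    ∃ M L : ℝ, (∀ n, ‖x n‖ ≤ M) ∧ Tendsto (fun n => phi (x 0) (x n)) atTop (𝓝 L) ∧
      (∀ n, phi (x 0) (x n) ≤ L) ∧ Tendsto (fun n => x n - t n) atTop (𝓝 0) := by
  have hD := hseq.solution_mem hE hu hcut
  have hle : ∀ n, phi (x 0) (x n) ≤ phi (x 0) u := fun n => by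
    have h1 := phi_add_phi_le_of_mem_cutD (hD n)
    have h2 := phi_nonneg (x n) u
    linarith
  have hM : ∀ n, ‖x n‖ ≤ ‖x 0‖ + (phi (x 0) u + 1) := fun n => norm_le_of_phi_le (hle n) le_rfl
  have hinc : ∀ n, phi (x 0) (x n) + phi (x n) (x (n + 1)) ≤ phi (x 0) (x (n + 1)) := fun n =>
    phi_add_phi_le_of_mem_cutD (hseq.succ_mem n).2
  have hmono : Monotone fun n => phi (x 0) (x n) := monotone_nat_of_le_succ fun n => by
    have h1 := hinc n
    have h2 := phi_nonneg (x n) (x (n + 1))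
    linarith
  have hbdd : BddAbove (Set.range fun n => phi (x 0) (x n)) :=
    ⟨_, by rintro _ ⟨n, rfl⟩; exact hle n⟩
  have hL := tendsto_atTop_ciSup hmono hbdd
  refine ⟨_, _, hM, hL, fun n => le_ciSup hbdd n, ?_⟩
  have h1 : Tendsto (fun n => phi (x n) (x (n + 1))) atTop (𝓝 0) := by
    refine squeeze_zero (g := fun n => phi (x 0) (x (n + 1)) - phi (x 0) (x n))
      (fun n => phi_nonneg _ _) (fun n => by linarith [hinc n]) ?_
    simpa using (hL.comp (tendsto_add_atTop_nat 1)).sub hL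
  have h2 : Tendsto (fun n => x n - x (n + 1)) atTop (𝓝 0) := tendsto_sub_of_tendsto_phi_left hM h1
  have h3 : Tendsto (fun n => x (n + 1) - x n) atTop (𝓝 0) := by simpa using h2.neg
  have h4 : Tendsto (fun n => phi (x (n + 1)) (t n)) atTop (𝓝 0) :=
    squeeze_zero (fun n => phi_nonneg _ _) (fun n => (hseq.succ_mem n).1.2)
      (tendsto_phi_of_tendsto_sub (fun n => hM (n + 1)) hM h3)
  have h5 := tendsto_sub_of_tendsto_phi_left (fun n => hM (n + 1)) h4
  simpa using h2.add h5

end AsymptoticRegularity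

end EquilibriumExtragradient

/-! ### Proof of the main theorem. -/

theorem theorem3p1 {E : Type*} [NormedAddCommGroup E] [NormedSpace ℝ E] [CompleteSpace E]
    [UniformConvexSpace E] (hE : UniformlySmooth E)
    (C : Set E) (hC_nonempty : C.Nonempty) (hC_closed : IsClosed C) (hC_convex : Convex ℝ C)
    (f : E → E → ℝ) (c₁ c₂ : ℝ) (hc₁ : 0 < c₁) (hc₂ : 0 < c₂)
    (hA1 : CondA1 C f) (hA2 : CondA2 C f) (hA3 : CondA3 C f) (hA4 : CondA4 C f)
    (hA5 : CondA5 C f c₁ c₂)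
    (S : E → E) (hS : RelativelyNonexpansive C S)
    (hΩ : (equilibriumSet C f ∩ fixedPoints C S).Nonempty)
    (α β lam : ℕ → ℝ) (a e d b lamMin lamMax : ℝ)
    (ha : 0 < a) (hae : a < e) (he : e < 1) (hα : ∀ n, α n ∈ Set.Icc a e)
    (hd : 0 < d) (hdb : d < b) (hb : b < 1) (hβ : ∀ n, β n ∈ Set.Icc d b)
    (hlam : ∀ n, lam n ∈ Set.Ioc 0 1) (hlam' : ∀ n, lam n ∈ Set.Icc lamMin lamMax)
    (hlamMin : 0 < lamMin) (hlamMinMax : lamMin ≤ lamMax)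
    (hlamMax : lamMax < min (1 / (2 * c₁)) (1 / (2 * c₂)))
    (x y z t : ℕ → E) (hseq : ExtragradientSequences C f S α β lam x y z t) :
    ∃ u ∈ equilibriumSet C f ∩ fixedPoints C S,
      Tendsto x atTop (𝓝 u) ∧ Tendsto y atTop (𝓝 u) ∧
      Tendsto z atTop (𝓝 u) ∧ Tendsto t atTop (𝓝 u) ∧
      ∀ R : E → E,
        SunnyGeneralizedNonexpansiveRetraction R (equilibriumSet C f ∩ fixedPoints C S) →
          R (x 0) = u := by
  have hκ : ∀ c : ℝ, 0 < c → lamMax < 1 / (2 * c) →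
      0 < 1 - 2 * (lamMax * c) ∧ ∀ n, 1 - 2 * (lamMax * c) ≤ 1 - 2 * (lam n * c) := by
    intro c hc h
    rw [lt_div_iff₀ (by positivity)] at h
    refine ⟨by linarith, fun n => ?_⟩
    have := mul_le_mul_of_nonneg_right (hlam' n).2 hc.le
    linarith
  obtain ⟨hκ₁, hκ₁'⟩ := hκ c₁ hc₁ (hlamMax.trans_le (min_le_left _ _))
  obtain ⟨hκ₂, hκ₂'⟩ := hκ c₂ hc₂ (hlamMax.trans_le (min_le_right _ _))
  set κ₁ := 1 - 2 * (lamMax * c₁)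
  set κ₂ := 1 - 2 * (lamMax * c₂)
  have he' : 0 < 1 - e := sub_pos.2 he
  have hstep : ∀ u ∈ equilibriumSet C f ∩ fixedPoints C S, ∀ n,
      phi u (t n) + (a * phi (t n) (x n) +
        (1 - e) * (κ₁ * phi (y n) (x n) + κ₂ * phi (z n) (y n))) ≤ phi u (x n) := by
    intro u hu n
    refine le_trans ?_ (phi_step_le hE hA2 hA4 hA5 hS (hlam n).1.le
      ⟨ha.le.trans (hα n).1, (hα n).2.trans he.le⟩ ⟨hd.le.trans (hβ n).1, (hβ n).2.trans hb.le⟩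
      (hseq.mem n) (hseq.y_step n) (hseq.z_step n) (hseq.t_step n) hu)
    have h1 := phi_nonneg (t n) (x n)
    have h2 := phi_nonneg (y n) (x n)
    have h3 := phi_nonneg (z n) (y n)
    have h4 := hκ₁' n
    have h5 := hκ₂' n
    gcongr
    · exact (hα n).1
    · linarith [(hα n).2]
    · exact (hα n).2
  have hcutle : ∀ u ∈ equilibriumSet C f ∩ fixedPoints C S, ∀ n, phi u (t n) ≤ phi u (x n) := by
    intro u hu n
    have h1 := hstep u hu n
    have h2 := phi_nonneg (t n) (x n)
    have h3 := phi_nonneg (y n) (x n)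
    have h4 := phi_nonneg (z n) (y n)
    have : 0 ≤ a * phi (t n) (x n) + (1 - e) * (κ₁ * phi (y n) (x n) + κ₂ * phi (z n) (y n)) := by
      positivity
    linarith
  obtain ⟨u₀, hu₀⟩ := hΩ
  obtain ⟨M, L, hM, hL, hLle, hxt⟩ :=
    hseq.tendsto_sub_of_forall_phi_le hE hu₀.1.1 (hcutle u₀ hu₀)
  have hJxt := tendsto_J_sub_J hE hM hxt
  obtain ⟨M', hM'⟩ := exists_norm_le_of_tendsto_sub hM hxt
  have htx : Tendsto (fun n => t n - x n) atTop (𝓝 0) := by simpa using hxt.neg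
  have hgap : Tendsto (fun n => phi u₀ (x n) - phi u₀ (t n)) atTop (𝓝 0) := by
    refine squeeze_zero
      (g := fun n => phi (t n) (x n) + 2 * (‖J (x n) - J (t n)‖ * (‖u₀‖ + M')))
      (fun n => sub_nonneg.2 (hcutle u₀ hu₀ n)) (fun n => ?_) ?_
    · have h1 := phi_three_point u₀ (t n) (x n)
      have h2 := (le_abs_self _).trans ((J (t n) - J (x n)).le_opNorm (u₀ - t n))
      have h3 : ‖J (t n) - J (x n)‖ * ‖u₀ - t n‖ ≤ ‖J (x n) - J (t n)‖ * (‖u₀‖ + M') := by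
        rw [norm_sub_rev (J (t n))]
        gcongr
        exact (norm_sub_le _ _).trans (by gcongr; exact hM' n)
      linarith
    · have h1 := tendsto_phi_of_tendsto_sub (fun n => (hM' n).trans (le_max_left M' M))
        (fun n => (hM n).trans (le_max_right M' M)) htx
      simpa using h1.add ((hJxt.norm.mul_const (‖u₀‖ + M')).const_mul 2)
  have hφ : ∀ n, (1 - e) * (κ₁ * phi (y n) (x n)) ≤ phi u₀ (x n) - phi u₀ (t n) ∧
      (1 - e) * (κ₂ * phi (z n) (y n)) ≤ phi u₀ (x n) - phi u₀ (t n) := by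
    intro n
    have h1 := hstep u₀ hu₀ n
    have h2 := mul_nonneg ha.le (phi_nonneg (t n) (x n))
    have h3 := mul_nonneg he'.le (mul_nonneg hκ₁.le (phi_nonneg (y n) (x n)))
    have h4 := mul_nonneg he'.le (mul_nonneg hκ₂.le (phi_nonneg (z n) (y n)))
    constructor <;> linarith
  have hyx : Tendsto (fun n => y n - x n) atTop (𝓝 0) := by
    refine tendsto_sub_of_tendsto_phi_right hM ?_
    refine squeeze_zero (fun n => phi_nonneg _ _) (fun n => ?_)
      (by simpa using hgap.div_const ((1 - e) * κ₁))
    rw [le_div_iff₀ (by positivity)]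
    linarith [(hφ n).1]
  have hxy : Tendsto (fun n => x n - y n) atTop (𝓝 0) := by simpa using hyx.neg
  obtain ⟨My, hMy⟩ := exists_norm_le_of_tendsto_sub hM hxy
  have hzy : Tendsto (fun n => z n - y n) atTop (𝓝 0) := by
    refine tendsto_sub_of_tendsto_phi_right hMy ?_
    refine squeeze_zero (fun n => phi_nonneg _ _) (fun n => ?_)
      (by simpa using hgap.div_const ((1 - e) * κ₂))
    rw [le_div_iff₀ (by positivity)]
    linarith [(hφ n).2]
  have hzx : Tendsto (fun n => z n - x n) atTop (𝓝 0) := by simpa using hzy.add hyx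
  have hJxy := tendsto_J_sub_J hE hM hxy
  have hJxz := tendsto_J_sub_J hE hM (by simpa using hzx.neg : Tendsto (fun n => x n - z n) _ _)
  have hJSx : Tendsto (fun n => J (S (z n)) - J (x n)) atTop (𝓝 0) := by
    have hb' : 0 < 1 - b := sub_pos.2 hb
    refine squeeze_zero_norm
      (a := fun n => (‖J (x n) - J (t n)‖ + ‖J (x n) - J (z n)‖) / ((1 - e) * (1 - b)))
      (fun n => ?_) (by simpa using (hJxt.norm.add hJxz.norm).div_const ((1 - e) * (1 - b)))
    have hα1 : 1 - e ≤ 1 - α n := by linarith [(hα n).2]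
    have hβ1 : 1 - b ≤ 1 - β n := by linarith [(hβ n).2]
    have hα0 : 0 ≤ 1 - α n := he'.le.trans hα1
    have hβ0 : 0 ≤ β n := hd.le.trans (hβ n).1
    -- The formula for `J (t n)` is solved for `J (S (z n))`; the bounds `e < 1` and `b < 1` keep
    -- the coefficient away from zero.
    have h1 : ((1 - α n) * (1 - β n)) • (J (S (z n)) - J (x n)) =
        -(J (x n) - J (t n)) + ((1 - α n) * β n) • (J (x n) - J (z n)) := by
      rw [hseq.t_step n]; module
    have h2 : ‖((1 - α n) * (1 - β n)) • (J (S (z n)) - J (x n))‖ ≤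
        ‖J (x n) - J (t n)‖ + ‖J (x n) - J (z n)‖ := by
      rw [h1]
      refine (norm_add_le _ _).trans ?_
      rw [norm_neg, norm_smul, Real.norm_of_nonneg (mul_nonneg hα0 hβ0)]
      have h3 : (1 - α n) * β n ≤ 1 * 1 := by
        gcongr
        · linarith [(hα n).1]
        · linarith [(hβ n).2]
      gcongr
      nlinarith [norm_nonneg (J (x n) - J (z n))]
    rw [norm_smul, Real.norm_of_nonneg (mul_nonneg hα0 (hb'.le.trans hβ1))] at h2
    rw [le_div_iff₀ (by positivity), mul_comm]
    refine le_trans ?_ h2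
    gcongr
  have hSx := tendsto_sub_of_tendsto_J_sub_J hM hJSx
  have hSz : Tendsto (fun n => S (z n) - z n) atTop (𝓝 0) := by simpa using hSx.sub hzx
  obtain ⟨p, k, hk, hp⟩ := exists_weaklyConverges_subseq hE hM
  have hkt := hk.tendsto_atTop
  have hpy : WeaklyConverges (y ∘ k) p := hp.of_tendsto_sub (hyx.comp hkt)
  have hpz : WeaklyConverges (z ∘ k) p := hp.of_tendsto_sub (hzx.comp hkt)
  have hpC : p ∈ C := mem_of_weaklyConverges hC_closed hC_convex (fun n => hseq.mem (k n)) hp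
  have hpS : p ∈ fixedPoints C S := by
    rw [← hS.asymptotic_eq]
    exact ⟨hpC, z ∘ k, fun n => (hseq.z_step (k n)).1, hpz, hSz.comp hkt⟩
  have hpf : ∀ v ∈ C, 0 ≤ f p v := by
    intro v hv
    have hconst : WeaklyConverges (fun _ => v) v := fun ξ => tendsto_const_nhds
    have h1 := hA3 p hpC v hv (x ∘ k) (fun _ => v) (fun n => hseq.mem _) (fun _ => hv) hp hconst
    have h2 := hA3 p hpC p hpC (x ∘ k) (y ∘ k) (fun n => hseq.mem _)
      (fun n => (hseq.y_step (k n)).1) hp hpy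
    rw [hA1 p hpC] at h2
    -- The filter `map k atTop` lets the lower bound be proved for every `n` while the limit is
    -- taken along the subsequence. Dividing by `lam n` costs at most a factor `1 / lamMin`.
    have h3 : Tendsto (fun n => f (x n) v - f (x n) (y n) +
        ‖J (x n) - J (y n)‖ * (‖v‖ + My) / lamMin) (map k atTop) (𝓝 (f p v)) := by
      rw [tendsto_map'_iff]
      simpa [Function.comp_def] using
        (h1.sub h2).add (((hJxy.comp hkt).norm.mul_const (‖v‖ + My)).div_const lamMin)
    refine ge_of_tendsto' h3 fun n => ?_
    have h4 := (hseq.y_step n).variational_inequality hE (hA4 _ (hseq.mem n)).1 (hlam n).1.le hv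
    have h5 := (neg_le_abs _).trans ((J (x n) - J (y n)).le_opNorm (v - y n))
    have h6 : ‖J (x n) - J (y n)‖ * ‖v - y n‖ ≤ ‖J (x n) - J (y n)‖ * (‖v‖ + My) := by
      gcongr
      exact (norm_sub_le _ _).trans (by gcongr; exact hMy n)
    set r := ‖J (x n) - J (y n)‖ * (‖v‖ + My) with hr
    have hr0 : 0 ≤ r := le_trans (by positivity) h6
    have h7 : -r ≤ lam n * (f (x n) v - f (x n) (y n)) := by linarith
    have h8 : r ≤ lam n * (r / lamMin) := by
      calc r = lamMin * (r / lamMin) := by field_simp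
        _ ≤ lam n * (r / lamMin) := by gcongr; exact (hlam' n).1
    have h9 : 0 ≤ lam n * (f (x n) v - f (x n) (y n) + r / lamMin) := by linarith
    exact nonneg_of_mul_nonneg_right h9 (hlam n).1
  have hpΩ : p ∈ equilibriumSet C f ∩ fixedPoints C S := ⟨⟨hpC, hpf⟩, hpS⟩
  have hx : Tendsto x atTop (𝓝 p) := by
    refine hseq.tendsto_of_weaklyConverges hE hM hL hLle hp fun n => ?_
    rcases (phi_nonneg (t n) (x n)).eq_or_lt with h | h
    · exact Or.inr (eq_of_phi_nonpos h.ge)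
    · left
      have h1 := hstep p hpΩ n
      have h2 := mul_pos ha h
      have h3 := mul_nonneg he'.le (add_nonneg (mul_nonneg hκ₁.le (phi_nonneg (y n) (x n)))
        (mul_nonneg hκ₂.le (phi_nonneg (z n) (y n))))
      linarith
  refine ⟨p, hpΩ, hx, by simpa using hyx.add hx, by simpa using hzx.add hx,
    by simpa using htx.add hx, fun R hR => eq_of_phi_nonpos ?_⟩
  -- The variational inequality of `R` has the form of membership of `p` in `cutD C (x 0) (R (x
  -- 0))`. Conversely `R (x 0)` lies in every `cutD C (x 0) (x n)`, so the limit gives the opposite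
  -- comparison and `φ(R (x 0), p) ≤ 0`.
  have h1 : phi (x 0) (R (x 0)) + phi (R (x 0)) p ≤ phi (x 0) p :=
    phi_add_phi_le_of_mem_cutD (C := C) ⟨hpC, hR.variational_inequality hE (x 0) hpΩ⟩
  have hcont : ∀ w, Continuous fun v : E => phi w v := fun w => by
    have : Continuous fun v : E => J v w := (continuous_J hE).clm_apply continuous_const
    unfold phi
    fun_prop
  have h2 : phi (x 0) p ≤ phi (x 0) (R (x 0)) := by
    refine le_of_tendsto (((hcont (x 0)).tendsto p).comp hx) (Eventually.of_forall fun n => ?_)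
    have hmem := hR.mem (x 0)
    have h3 := phi_add_phi_le_of_mem_cutD (hseq.solution_mem hE hmem.1.1 (hcutle _ hmem) n)
    have h4 := phi_nonneg (x n) (R (x 0))
    simp only [Function.comp_apply]
    linarith
  linarith
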